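/- **Theorem (Characterizations of the winning sets).** An arena consists of a countable set $V$ of vertices, partitioned into Eve's vertices $V_E$ and Adam's vertices $V_A$, and an edge relation $E \subseteq V \times V$ such that every vertex has an outgoing edge. A strategy for Eve (resp. Adam) is a function $\sigma : V^* \cdot V_E \to V$ (resp. $\tau : V^* \cdot V_A \to V$) that maps a finite history and a current vertex $v$ to a successor of $v$; a starting vertex $v_0$, a strategy $\sigma$ for Eve and a strategy $\tau$ for Adam determine a unique infinite play. For a set $\Omega$ of plays, $W_E(\Omega)$ is the set of vertices $v_0$ such that Eve has a strategy $\sigma$ for which, for all strategies $\tau$ of Adam, the play from $v_0$ given by $\sigma$ and $\tau$ is in $\Omega$. For $S \subseteq V$ let $$\mathrm{Pre}(S) = \{u \in V_E \mid \exists (u,v) \in E,\ v \in S\} \cup \{u \in V_A \mid \forall (u,v) \in E,\ v \in S\},$$ $\mathrm{Attr}_0(S) = S$ and $\mathrm{Attr}_{k+1}(S) = \mathrm{Attr}_k(S) \cup \mathrm{Pre}(\mathrm{Attr}_k(S))$. For $F \subseteq V$, a play $\pi = \pi_0 \pi_1 \cdots$ and a position $k$, let $\mathrm{dist}_k(\pi,F)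 = \inf\{k'-k \mid k' \ge k,\ \pi_{k'} \in F\} \in \mathbb{N} \cup \{\infty\}$ (with $\inf \emptyset = \infty$), and for $N \in \mathbb{N}$ let $$\mathrm{BndB\ddot{u}chi}(F,N) = \{\pi \mid \sup_k \mathrm{dist}_k(\pi,F) \le N\},\quad \mathrm{B\ddot{u}chi}(F,N) = \{\pi \mid \limsup_k \mathrm{dist}_k(\pi,F) \le N\},$$ $$\mathrm{FinB\ddot{u}chi}(F) = \{\pi \mid \limsup_k \mathrm{dist}_k(\pi,F) < \infty\}.$$ Write $\mu$ and $\nu$ for the least and greatest fixpoints of monotone operators on the subsets of $V$, ordered by inclusion. Then for every arena and every $F \subseteq V$: 1. for all $N \ge 0$, $W_E(\mathrm{BndB\ddot{u}chi}(F,N)) = \nu Z.\ \mathrm{Attr}_N(F \cap \mathrm{Pre}(Z))$; 2. for all $N \ge 1$, $W_E(\mathrm{B\ddot{u}chi}(F,N)) = \mu Y.\ \nu Z.\ \mathrm{Attr}_N((F \cup Y) \cap \mathrm{Pre}(Z))$; 3. $W_E(\mathrm{FinB\ddot{u}chi}(F)) = \mu X.\ \bigcup_{N \in \mathbb{N}}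 \mu Y.\ \nu Z.\ \mathrm{Attr}_N((F \cup Y \cup X) \cap \mathrm{Pre}(Z))$. -/

import Mathlib

/-- An arena with vertex set `V`: the edge relation `E`, the set `VE` of Eve's vertices (all other
vertices belong to Adam), and no dead ends. -/
structure Arena (V : Type*) where
  VE : Set V
  E : V → V → Prop
  noDeadEnd : ∀ v, ∃ v', E v v'

namespace Arena

variable {V : Type*} (A : Arena V)

/-- The set of Adam's vertices. -/
def VA : Set V := A.VEᶜ

/-- A strategy for Eve: a function `V^* · V_E → V` (past history, then current vertex) whose moves
follow edges. -/
structure EveStrategy where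
  move : List V → A.VE → V
  legal : ∀ (w : List V) (v : A.VE), A.E v (move w v)

/-- A strategy for Adam: a function `V^* · V_A → V` whose moves follow edges. -/
structure AdamStrategy where
  move : List V → A.VA → V
  legal : ∀ (w : List V) (v : A.VA), A.E v (move w v)

open Classical in
/-- The position after `n` moves: the vertices visited before (in chronological order) and the
current vertex. -/
noncomputable def run (v₀ : V) (σ : A.EveStrategy) (τ : A.AdamStrategy) : ℕ → List V × V
  | 0 => ([], v₀)
  | n + 1 =>
    let w := (run v₀ σ τ n).1
    let v := (run v₀ σ τ n).2
    (w ++ [v], if h : v ∈ A.VE then σ.move w ⟨v, h⟩ else τ.move w ⟨v, h⟩)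

/-- The unique play from `v₀` in which Eve follows `σ` and Adam follows `τ`. -/
noncomputable def play (v₀ : V) (σ : A.EveStrategy) (τ : A.AdamStrategy) (n : ℕ) : V :=
  (A.run v₀ σ τ n).2

/-- Eve's winning set for the condition `Ω`. -/
def winE (Ω : Set (ℕ → V)) : Set V :=
  {v₀ | ∃ σ : A.EveStrategy, ∀ τ : A.AdamStrategy, A.play v₀ σ τ ∈ Ω}

/-- The vertices from which Eve can ensure to be in `F` after one move. -/
def pre (F : Set V) : Set V :=
  {u | u ∈ A.VE ∧ ∃ v, A.E u v ∧ v ∈ F} ∪ {u | u ∈ A.VA ∧ ∀ v, A.E u v → v ∈ F}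

/-- The step-indexed attractor sequence for Eve. -/
def attr : ℕ → Set V → Set V
  | 0, F => F
  | k + 1, F => attr k F ∪ A.pre (attr k F)

theorem pre_mono : Monotone A.pre := by
  rintro S T h u (⟨hu, v, hv, hS⟩ | ⟨hu, hS⟩)
  · exact Or.inl ⟨hu, v, hv, h hS⟩
  · exact Or.inr ⟨hu, fun v hv => h (hS v hv)⟩

theorem attr_mono (N : ℕ) : Monotone (A.attr N) := by
  induction N with
  | zero => exact fun S T h => h
  | succ k ih => exact fun S T h => Set.union_subset_union (ih h) (A.pre_mono (ih h))

/-- The monotone operator `Z ↦ Attr_N (S ∩ Pre Z)`. -/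
def attrPre (N : ℕ) (S : Set V) : Set V →o Set V where
  toFun Z := A.attr N (S ∩ A.pre Z)
  monotone' _ _ h := A.attr_mono N (Set.inter_subset_inter_right S (A.pre_mono h))

theorem attrPre_mono (N : ℕ) : Monotone (A.attrPre N) :=
  fun _ _ h _ => A.attr_mono N (Set.inter_subset_inter_left _ h)

/-- The monotone operator `Y ↦ νZ. Attr_N ((F ∪ Y) ∩ Pre Z)`. -/
def uniformOp (N : ℕ) (F : Set V) : Set V →o Set V where
  toFun Y := (A.attrPre N (F ∪ Y)).gfp
  monotone' _ _ h :=
    OrderHom.gfp.monotone (A.attrPre_mono N (Set.union_subset_union_right F h))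

/-- The monotone operator `Y ↦ νZ. Attr_N ((F ∪ Y ∪ X) ∩ Pre Z)`. -/
def finitaryInnerOp (N : ℕ) (F X : Set V) : Set V →o Set V where
  toFun Y := (A.attrPre N (F ∪ Y ∪ X)).gfp
  monotone' _ _ h := OrderHom.gfp.monotone (A.attrPre_mono N
    (Set.union_subset_union_left X (Set.union_subset_union_right F h)))

theorem finitaryInnerOp_mono (N : ℕ) (F : Set V) : Monotone (A.finitaryInnerOp N F) :=
  fun _ _ h Y => OrderHom.gfp.monotone (A.attrPre_mono N (Set.union_subset_union_right (F ∪ Y) h))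

/-- The monotone operator `X ↦ ⋃_N μY. νZ. Attr_N ((F ∪ Y ∪ X) ∩ Pre Z)`. -/
def finitaryOp (F : Set V) : Set V →o Set V where
  toFun X := ⋃ N : ℕ, (A.finitaryInnerOp N F X).lfp
  monotone' _ _ h :=
    Set.iUnion_mono fun N => OrderHom.lfp.monotone (A.finitaryInnerOp_mono N F h)

end Arena

/-- The number of steps from position `k` of `π` to the next vertex in `F` (`⊤` if there is
none). -/
noncomputable def buchiDist {V : Type*} (F : Set V) (π : ℕ → V) (k : ℕ) : ℕ∞ :=
  ⨅ (k' : ℕ) (_ : k ≤ k' ∧ π k' ∈ F), ((k' - k : ℕ) : ℕ∞)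

/-- The bounded uniform Büchi condition with bound `N`. -/
def BndBuchi {V : Type*} (F : Set V) (N : ℕ) : Set (ℕ → V) :=
  {π | (⨆ k, buchiDist F π k) ≤ (N : ℕ∞)}

/-- The uniform Büchi condition with bound `N`. -/
def UniformBuchi {V : Type*} (F : Set V) (N : ℕ) : Set (ℕ → V) :=
  {π | Filter.limsup (buchiDist F π) Filter.atTop ≤ (N : ℕ∞)}

/-- The finitary Büchi condition. -/
def FinBuchi {V : Type*} (F : Set V) : Set (ℕ → V) :=
  {π | Filter.limsup (buchiDist F π) Filter.atTop < ⊤}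

/-! Quantifying over Adam's strategies amounts to quantifying over plays consistent with `σ`. (1)
The bounded condition survives deleting prefixes, so Eve is still winning when `F` is hit: her
winning set is a post-fixpoint. Conversely, inside the greatest fixpoint, decreasing the attractor
rank hits `F` within `N` steps, again and again. (2), (3) The least fixpoint lies in the winning set
by fixpoint induction: Eve switches strategy on reaching a vertex already won
(`mem_winE_of_switch`). For the converse, let `X` be the least fixpoint. Outside `X`, Eve loses the
bounded condition for `F ∪ X`, so each of her strategies admits a long window avoiding `F ∪ X`. It
ends outside `X`, so this repeats (`exists_consistent_delays`). Windows of constant length refute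
the uniform condition, growing ones the finitary condition. -/

namespace Arena

/-! ### Plays consistent with a strategy -/

variable {V : Type*} (A : Arena V)

/-- The play `π` starts in `v₀`, follows edges, and follows `σ` at Eve's vertices. -/
def Consistent (σ : A.EveStrategy) (v₀ : V) (π : ℕ → V) : Prop :=
  π 0 = v₀ ∧ ∀ n, A.E (π n) (π (n + 1)) ∧
    ∀ h : π n ∈ A.VE, π (n + 1) = σ.move ((List.range n).map π) ⟨π n, h⟩

/-- The strategy `σ` after the history `w`. -/
def EveStrategy.residual {A : Arena V} (σ : A.EveStrategy) (w : List V) : A.EveStrategy where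
  move w' v := σ.move (w ++ w') v
  legal w' v := σ.legal (w ++ w') v

theorem EveStrategy.residual_residual {A : Arena V} (σ : A.EveStrategy) (w w' : List V) :
    (σ.residual w).residual w' = σ.residual (w ++ w') := by
  simp [EveStrategy.residual, List.append_assoc]

theorem run_fst (v₀ : V) (σ : A.EveStrategy) (τ : A.AdamStrategy) (n : ℕ) :
    (A.run v₀ σ τ n).1 = (List.range n).map (A.play v₀ σ τ) := by
  induction n with
  | zero => rfl
  | succ n ih => rw [List.range_succ, List.map_append, ← ih]; rfl

open Classical in
theorem play_succ (v₀ : V) (σ : A.EveStrategy) (τ : A.AdamStrategy) (n : ℕ) :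
    A.play v₀ σ τ (n + 1) =
      if h : A.play v₀ σ τ n ∈ A.VE then
        σ.move ((List.range n).map (A.play v₀ σ τ)) ⟨A.play v₀ σ τ n, h⟩
      else τ.move ((List.range n).map (A.play v₀ σ τ)) ⟨A.play v₀ σ τ n, h⟩ := by
  rw [← run_fst]; rfl

theorem consistent_play (v₀ : V) (σ : A.EveStrategy) (τ : A.AdamStrategy) :
    A.Consistent σ v₀ (A.play v₀ σ τ) := by
  refine ⟨rfl, fun n => ⟨?_, fun h => ?_⟩⟩
  · rw [play_succ]
    split_ifs with h
    · exact σ.legal _ ⟨_, h⟩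
    · exact τ.legal _ ⟨_, h⟩
  · rw [play_succ, dif_pos h]

theorem Consistent.exists_play_eq {A : Arena V} {σ : A.EveStrategy} {v₀ : V} {π : ℕ → V}
    (hπ : A.Consistent σ v₀ π) : ∃ τ, A.play v₀ σ τ = π := by
  classical
  choose g hg using A.noDeadEnd
  -- Adam replays `π`, reading only the length of the history; `g` is the fallback where that move
  -- is illegal.
  let τ : A.AdamStrategy :=
    { move := fun w v => if A.E v (π (w.length + 1)) then π (w.length + 1) else g v
      legal := fun w v => by split_ifs with h; exacts [h, hg v] }
  refine ⟨τ, funext fun n => ?_⟩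
  induction n using Nat.strong_induction_on with
  | _ n ih =>
    cases n with
    | zero => exact hπ.1.symm
    | succ n =>
      have hn := ih n n.lt_succ_self
      have hw : (List.range n).map (A.play v₀ σ τ) = (List.range n).map π :=
        List.map_congr_left fun k hk => ih k ((List.mem_range.1 hk).trans n.lt_succ_self)
      rw [play_succ, hw]
      simp only [hn]
      split_ifs with h
      · exact ((hπ.2 n).2 h).symm
      · simp [τ, (hπ.2 n).1]

theorem exists_consistent (σ : A.EveStrategy) (v₀ : V) : ∃ π, A.Consistent σ v₀ π := by
  choose g hg using A.noDeadEnd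
  exact ⟨_, A.consistent_play v₀ σ ⟨fun _ v => g v, fun _ v => hg v⟩⟩

theorem mem_winE_iff {Ω : Set (ℕ → V)} {v₀ : V} :
    v₀ ∈ A.winE Ω ↔ ∃ σ : A.EveStrategy, ∀ π, A.Consistent σ v₀ π → π ∈ Ω := by
  refine exists_congr fun σ => ⟨fun h π hπ => ?_, fun h τ => h _ (A.consistent_play v₀ σ τ)⟩
  obtain ⟨τ, rfl⟩ := hπ.exists_play_eq
  exact h τ

theorem winE_mono {Ω Ω' : Set (ℕ → V)} (h : Ω ⊆ Ω') : A.winE Ω ⊆ A.winE Ω' :=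
  fun _ ⟨σ, hσ⟩ => ⟨σ, fun τ => h (hσ τ)⟩

/-! ### Cutting and splicing plays; attractors -/

variable {A}

theorem Consistent.cons {σ : A.EveStrategy} {v v' : V} {ρ : ℕ → V} (hE : A.E v v')
    (hσ : ∀ h : v ∈ A.VE, v' = σ.move [] ⟨v, h⟩) (hρ : A.Consistent (σ.residual [v]) v' ρ) :
    A.Consistent σ v (fun n => Nat.casesOn n v ρ) := by
  refine ⟨rfl, fun n => ?_⟩
  cases n with
  | zero =>
    refine ⟨?_, fun h => ?_⟩
    · change A.E v (ρ 0)
      rwa [hρ.1]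
    · exact hρ.1.trans (hσ h)
  | succ n =>
    refine ⟨(hρ.2 n).1, fun h => ?_⟩
    refine ((hρ.2 n).2 h).trans ?_
    rw [List.range_succ_eq_map, List.map_cons, List.map_map]
    rfl

theorem Consistent.tail {σ : A.EveStrategy} {v : V} {π : ℕ → V} (hπ : A.Consistent σ v π) :
    A.Consistent (σ.residual [v]) (π 1) (fun n => π (n + 1)) := by
  refine ⟨rfl, fun n => ⟨(hπ.2 (n + 1)).1, fun h => ?_⟩⟩
  refine ((hπ.2 (n + 1)).2 h).trans ?_
  rw [List.range_succ_eq_map, List.map_cons, List.map_map, hπ.1]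
  rfl

theorem Consistent.splice {n : ℕ} {σ : A.EveStrategy} {v : V} {π ρ : ℕ → V}
    (hπ : A.Consistent σ v π)
    (hρ : A.Consistent (σ.residual ((List.range n).map π)) (π n) ρ) :
    ∃ π', A.Consistent σ v π' ∧ (∀ k ≤ n, π' k = π k) ∧ ∀ k, π' (n + k) = ρ k := by
  induction n generalizing σ v π with
  | zero =>
    refine ⟨ρ, hπ.1 ▸ hρ, fun k hk => ?_, fun k => by rw [zero_add]⟩
    rw [Nat.le_zero.1 hk, hρ.1]
  | succ n ih =>
    have hw : (List.range (n + 1)).map π = [v] ++ (List.range n).map (fun n => π (n + 1)) := by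
      rw [List.range_succ_eq_map, List.map_cons, List.map_map, hπ.1]
      rfl
    rw [hw, ← EveStrategy.residual_residual] at hρ
    obtain ⟨π', h1, h2, h3⟩ := ih hπ.tail hρ
    refine ⟨fun n => Nat.casesOn n v π', h1.cons (hπ.1 ▸ (hπ.2 0).1) ?_, ?_, fun k => ?_⟩
    · obtain ⟨rfl, h⟩ := hπ
      exact (h 0).2
    · rintro (_ | k) hk
      · exact hπ.1.symm
      · exact h2 k (Nat.le_of_succ_le_succ hk)
    · rw [Nat.add_right_comm]
      exact h3 k

/-- If every play consistent with `σ` visits `S` within `k` steps, then the initial vertex is in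
the `k`-th attractor of `S`. -/
theorem mem_attr_of_forall_consistent {S : Set V} {k : ℕ} {σ : A.EveStrategy} {v : V}
    (h : ∀ π, A.Consistent σ v π → ∃ j ≤ k, π j ∈ S) : v ∈ A.attr k S := by
  induction k generalizing σ v with
  | zero =>
    obtain ⟨π, hπ⟩ := A.exists_consistent σ v
    obtain ⟨j, hj, hS⟩ := h π hπ
    rw [Nat.le_zero.1 hj, hπ.1] at hS
    exact hS
  | succ k ih =>
    by_cases hv : v ∈ S
    · refine Or.inl (ih (σ := σ) fun π hπ => ⟨0, k.zero_le, ?_⟩)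
      rwa [hπ.1]
    · have key : ∀ v', A.E v v' → (∀ h : v ∈ A.VE, v' = σ.move [] ⟨v, h⟩) →
          v' ∈ A.attr k S := by
        refine fun v' hE hσ => ih (σ := σ.residual [v]) fun ρ hρ => ?_
        obtain ⟨j, hj, hS⟩ := h _ (hρ.cons hE hσ)
        cases j with
        | zero => exact absurd hS hv
        | succ j => exact ⟨j, Nat.le_of_succ_le_succ hj, hS⟩
      by_cases hE : v ∈ A.VE
      · exact Or.inr (Or.inl ⟨hE, _, σ.legal [] ⟨v, hE⟩, key _ (σ.legal [] ⟨v, hE⟩) fun _ => rfl⟩)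
      · exact Or.inr (Or.inr ⟨hE, fun v' hv' => key v' hv' fun h => absurd h hE⟩)

/-- The residual of `σ` wins: any play against it splices onto the prefix of `π` into a play won by
`σ`, whose suffix stays in `Ω`. -/
theorem Consistent.mem_winE_of_suffix_closed {Ω : Set (ℕ → V)}
    (hΩ : ∀ π ∈ Ω, ∀ n, (fun k => π (n + k)) ∈ Ω) {σ : A.EveStrategy} {v : V}
    (hσ : ∀ π, A.Consistent σ v π → π ∈ Ω) {π : ℕ → V} (hπ : A.Consistent σ v π) (n : ℕ) :
    π n ∈ A.winE Ω := by
  refine A.mem_winE_iff.2 ⟨σ.residual ((List.range n).map π), fun ρ hρ => ?_⟩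
  obtain ⟨π', h1, -, h3⟩ := hπ.splice hρ
  have := hΩ π' (hσ π' h1) n
  rwa [funext h3] at this

theorem winE_subset_pre {Ω : Set (ℕ → V)} (hΩ : ∀ π ∈ Ω, ∀ n, (fun k => π (n + k)) ∈ Ω) :
    A.winE Ω ⊆ A.pre (A.winE Ω) := by
  intro v hv
  obtain ⟨σ, hσ⟩ := A.mem_winE_iff.1 hv
  have key : ∀ v', A.E v v' → (∀ h : v ∈ A.VE, v' = σ.move [] ⟨v, h⟩) → v' ∈ A.winE Ω := by
    refine fun v' hE hv' => A.mem_winE_iff.2 ⟨σ.residual [v], fun ρ hρ => ?_⟩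
    have := hΩ _ (hσ _ (hρ.cons hE hv')) 1
    simp only [Nat.add_comm 1] at this
    exact this
  by_cases hE : v ∈ A.VE
  · exact Or.inl ⟨hE, _, σ.legal [] ⟨v, hE⟩, key _ (σ.legal [] ⟨v, hE⟩) fun _ => rfl⟩
  · exact Or.inr ⟨hE, fun v' hv' => key v' hv' fun h => absurd h hE⟩

theorem attr_le_attr (S : Set V) : Monotone fun k => A.attr k S :=
  monotone_nat_of_le_succ fun _ => Set.subset_union_left

/-- Eve has a positional strategy which decreases the rank with respect to the attractor of
`S ∩ Pre Z`, and moves to `Z` from `S ∩ Pre Z`. -/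
theorem exists_attractor_strategy (S Z : Set V) :
    ∃ σ : A.EveStrategy, ∀ v π, A.Consistent σ v π → ∀ n,
      (π n ∈ S ∩ A.pre Z → π (n + 1) ∈ Z) ∧
      ∀ k, π n ∉ A.attr k (S ∩ A.pre Z) → π n ∈ A.attr (k + 1) (S ∩ A.pre Z) →
        π (n + 1) ∈ A.attr k (S ∩ A.pre Z) := by
  set T := S ∩ A.pre Z with hT
  have hstep : ∀ v, ∃ v', A.E v v' ∧ (v ∈ A.VE → (v ∈ T → v' ∈ Z) ∧
      ∀ k, v ∉ A.attr k T → v ∈ A.attr (k + 1) T → v' ∈ A.attr k T) := by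
    intro v
    by_cases hE : v ∈ A.VE
    · by_cases hv : v ∈ T
      · obtain ⟨-, v', hv', hZ⟩ | h := hv.2
        · exact ⟨v', hv', fun _ => ⟨fun _ => hZ, fun k hk =>
            absurd (attr_le_attr T k.zero_le hv) hk⟩⟩
        · exact absurd hE h.1
      · by_cases hk : ∃ k, v ∉ A.attr k T ∧ v ∈ A.attr (k + 1) T
        · obtain ⟨k, hk1, hk2⟩ := hk
          obtain ⟨-, v', hv', hk'⟩ | h := hk2.resolve_left hk1
          · refine ⟨v', hv', fun _ => ⟨fun h => absurd h hv, fun j hj1 hj2 => ?_⟩⟩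
            -- The rank is unique, but `k ≤ j` suffices because attractors grow.
            have h1 : k < j + 1 := lt_of_not_ge fun h => hk1 (attr_le_attr T h hj2)
            exact attr_le_attr T (Nat.le_of_lt_succ h1) hk'
          · exact absurd hE h.1
        · obtain ⟨v', hv'⟩ := A.noDeadEnd v
          exact ⟨v', hv', fun _ => ⟨fun h => absurd h hv, fun k h1 h2 => absurd ⟨k, h1, h2⟩ hk⟩⟩
    · obtain ⟨v', hv'⟩ := A.noDeadEnd v
      exact ⟨v', hv', fun h => absurd h hE⟩
  choose g hg hg' using hstep
  refine ⟨⟨fun _ v => g v, fun _ v => hg v⟩, fun v π hπ n => ?_⟩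
  by_cases hE : π n ∈ A.VE
  · rw [(hπ.2 n).2 hE]
    exact hg' _ hE
  · refine ⟨fun h => ?_, fun k h1 h2 => ?_⟩
    · exact (h.2.resolve_left fun h => hE h.1).2 _ (hπ.2 n).1
    · exact ((h2.resolve_left h1).resolve_left fun h => hE h.1).2 _ (hπ.2 n).1

/-! ### Switching strategies -/

/-- If Eve can ensure that every play either visits `winE Ω` or is in `Ω`, and `Ω` is closed under
adding prefixes, then Eve wins `Ω`. -/
theorem mem_winE_of_switch {Ω : Set (ℕ → V)} (hΩ : ∀ π n, (fun k => π (n + k)) ∈ Ω → π ∈ Ω)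
    {v : V} (h : v ∈ A.winE {π | (∃ n, π n ∈ A.winE Ω) ∨ π ∈ Ω}) : v ∈ A.winE Ω := by
  classical
  obtain ⟨σ, hσ⟩ := A.mem_winE_iff.1 h
  have hτ : ∀ u, ∃ τ : A.EveStrategy, u ∈ A.winE Ω → ∀ π, A.Consistent τ u π → π ∈ Ω := by
    intro u
    by_cases hu : u ∈ A.winE Ω
    · obtain ⟨τ, hτ⟩ := A.mem_winE_iff.1 hu
      exact ⟨τ, fun _ => hτ⟩
    · exact ⟨σ, fun h => absurd h hu⟩
  choose τ hτ using hτ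
  -- First visit to `winE Ω`, or the length of the list if there is none. The current vertex counts,
  -- so the switch is immediate and `τ` starts with an empty history.
  let idx : List V → ℕ := List.findIdx fun u => decide (u ∈ A.winE Ω)
  let σ' : A.EveStrategy :=
    { move := fun w v =>
        if h : idx (w ++ [v.1]) < (w ++ [v.1]).length then
          (τ (w ++ [v.1])[idx (w ++ [v.1])]).move (w.drop (idx (w ++ [v.1]))) v
        else σ.move w v
      legal := fun w v => by
        split_ifs
        · exact (τ _).legal _ _
        · exact σ.legal _ _ }
  refine A.mem_winE_iff.2 ⟨σ', fun π hπ => ?_⟩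
  have hsnoc : ∀ n, (List.range n).map π ++ [π n] = (List.range (n + 1)).map π := fun n => by
    simp [List.range_succ]
  by_cases hW : ∃ n, π n ∈ A.winE Ω
  · set n := Nat.find hW with hn
    refine hΩ π n (hτ (π n) (Nat.find_spec hW) _ ⟨rfl, fun k => ⟨(hπ.2 (n + k)).1, fun hE => ?_⟩⟩)
    refine ((hπ.2 (n + k)).2 hE).trans ?_
    have hlen : n < ((List.range (n + k)).map π ++ [π (n + k)]).length := by
      rw [hsnoc, List.length_map, List.length_range]; omega
    have hidx : idx ((List.range (n + k)).map π ++ [π (n + k)]) = n := by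
      refine (List.findIdx_eq hlen).2 ⟨?_, fun j hj => ?_⟩
      · simpa [hsnoc] using Nat.find_spec hW
      · simpa [hsnoc] using Nat.find_min hW hj
    have hdrop : ((List.range (n + k)).map π).drop n = (List.range k).map fun k => π (n + k) := by
      rw [List.range_add, List.map_append, List.drop_left' (by simp), List.map_map]
      rfl
    have hget : ((List.range (n + k)).map π ++ [π (n + k)])[n] = π n := by
      simp [hsnoc]
    simp only [σ', hidx, hlen, dif_pos, hdrop, hget]
  · refine (hσ π ⟨hπ.1, fun n => ⟨(hπ.2 n).1, fun hE => ?_⟩⟩).resolve_left hW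
    refine ((hπ.2 n).2 hE).trans (dif_neg ?_)
    rw [not_lt]
    refine (List.findIdx_eq_length.2 fun u hu => ?_).ge
    rw [hsnoc, List.mem_map] at hu
    obtain ⟨j, -, rfl⟩ := hu
    simpa using fun h => hW ⟨j, h⟩

end Arena

/-! ### The conditions as statements about windows -/

theorem buchiDist_le_iff {V : Type*} {F : Set V} {π : ℕ → V} {k N : ℕ} :
    buchiDist F π k ≤ N ↔ ∃ j ≤ N, π (k + j) ∈ F := by
  constructor
  · intro h
    have h' : buchiDist F π k < ((N + 1 : ℕ) : ℕ∞) :=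
      h.trans_lt (by exact_mod_cast N.lt_succ_self)
    simp only [buchiDist, iInf_lt_iff] at h'
    obtain ⟨k', ⟨hk, hF⟩, hlt⟩ := h'
    have : k' - k < N + 1 := by exact_mod_cast hlt
    exact ⟨k' - k, by omega, by rwa [Nat.add_sub_cancel' hk]⟩
  · rintro ⟨j, hj, hF⟩
    refine (iInf₂_le (k + j) ⟨Nat.le_add_right k j, hF⟩).trans ?_
    rw [Nat.add_sub_cancel_left]
    exact_mod_cast hj

theorem mem_bndBuchi_iff {V : Type*} {F : Set V} {N : ℕ} {π : ℕ → V} :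
    π ∈ BndBuchi F N ↔ ∀ k, ∃ j ≤ N, π (k + j) ∈ F := by
  simp only [BndBuchi, Set.mem_ofPred_eq, iSup_le_iff, buchiDist_le_iff]

theorem mem_uniformBuchi_iff {V : Type*} {F : Set V} {N : ℕ} {π : ℕ → V} :
    π ∈ UniformBuchi F N ↔ ∃ m, ∀ k ≥ m, ∃ j ≤ N, π (k + j) ∈ F := by
  simp only [← buchiDist_le_iff, ← Filter.eventually_atTop]
  constructor
  · intro h
    -- Only a strict bound on the limsup holds eventually; integrality turns `< N + 1` back into `≤
    -- N`.
    have h' : Filter.limsup (buchiDist F π) Filter.atTop < ((N + 1 : ℕ) : ℕ∞) :=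
      lt_of_le_of_lt h (by exact_mod_cast N.lt_succ_self)
    filter_upwards [Filter.eventually_lt_of_limsup_lt h'] with k hk
    exact Order.le_of_lt_add_one (by exact_mod_cast hk)
  · exact fun h => Filter.limsup_le_of_le (by isBoundedDefault) h

theorem mem_finBuchi_iff {V : Type*} {F : Set V} {π : ℕ → V} :
    π ∈ FinBuchi F ↔ ∃ N, π ∈ UniformBuchi F N := by
  constructor
  · intro h
    obtain ⟨N, hN⟩ := ENat.ne_top_iff_exists.1 (ne_of_lt h)
    exact ⟨N, hN.ge⟩
  · rintro ⟨N, hN⟩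
    exact lt_of_le_of_lt hN (ENat.natCast_lt_top N)

theorem bndBuchi_subset_uniformBuchi {V : Type*} (F : Set V) (N : ℕ) :
    BndBuchi F N ⊆ UniformBuchi F N := fun _ h =>
  mem_uniformBuchi_iff.2 ⟨0, fun k _ => mem_bndBuchi_iff.1 h k⟩

theorem uniformBuchi_of_suffix {V : Type*} {F : Set V} {N : ℕ} (π : ℕ → V) (n : ℕ)
    (h : (fun k => π (n + k)) ∈ UniformBuchi F N) : π ∈ UniformBuchi F N := by
  obtain ⟨m, hm⟩ := mem_uniformBuchi_iff.1 h
  refine mem_uniformBuchi_iff.2 ⟨n + m, fun k hk => ?_⟩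
  obtain ⟨j, hj, hF⟩ := hm (k - n) (by omega)
  exact ⟨j, hj, by rwa [show k + j = n + (k - n + j) by omega]⟩

namespace Arena

variable {V : Type*} {A : Arena V}

/-! ### The bounded condition -/

theorem winE_bndBuchi (F : Set V) (N : ℕ) : A.winE (BndBuchi F N) = (A.attrPre N F).gfp := by
  apply Set.Subset.antisymm
  · have hΩ : ∀ π ∈ BndBuchi F N, ∀ n, (fun k => π (n + k)) ∈ BndBuchi F N := by
      refine fun π hπ n => mem_bndBuchi_iff.2 fun k => ?_
      simpa only [Nat.add_assoc] using mem_bndBuchi_iff.1 hπ (n + k)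
    refine OrderHom.le_gfp _ fun v hv => ?_
    obtain ⟨σ, hσ⟩ := A.mem_winE_iff.1 hv
    refine mem_attr_of_forall_consistent (σ := σ) fun π hπ => ?_
    obtain ⟨j, hj, hF⟩ := mem_bndBuchi_iff.1 (hσ π hπ) 0
    rw [zero_add] at hF
    exact ⟨j, hj, hF, winE_subset_pre hΩ (hπ.mem_winE_of_suffix_closed hΩ hσ j)⟩
  · intro v hv
    set Z := (A.attrPre N F).gfp with hZ
    have hfix : A.attr N (F ∩ A.pre Z) = Z := (A.attrPre N F).map_gfp
    obtain ⟨σ, hσ⟩ := A.exists_attractor_strategy F Z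
    refine A.mem_winE_iff.2 ⟨σ, fun π hπ => mem_bndBuchi_iff.2 ?_⟩
    have hrank : ∀ k ≤ N, ∀ n, π n ∈ A.attr k (F ∩ A.pre Z) →
        π (n + 1) ∈ Z ∧ ∃ j ≤ k, π (n + j) ∈ F := by
      intro k
      induction k with
      | zero => exact fun _ n hn => ⟨(hσ v π hπ n).1 hn, 0, le_rfl, hn.1⟩
      | succ k ih =>
        intro hk n hn
        by_cases hn' : π n ∈ A.attr k (F ∩ A.pre Z)
        · obtain ⟨h1, j, hj, hF⟩ := ih (by omega) n hn'
          exact ⟨h1, j, by omega, hF⟩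
        · have h1 := (hσ v π hπ n).2 k hn' hn
          obtain ⟨-, j, hj, hF⟩ := ih (by omega) (n + 1) h1
          refine ⟨hfix ▸ attr_le_attr _ (by omega : k ≤ N) h1, j + 1, by omega, ?_⟩
          rwa [show n + (j + 1) = n + 1 + j by omega]
    have hmem : ∀ n, π n ∈ Z := by
      intro n
      induction n with
      | zero => rwa [hπ.1]
      | succ n ih => exact (hrank N le_rfl n (hfix.symm ▸ ih)).1
    exact fun n => (hrank N le_rfl n (hfix.symm ▸ hmem n)).2

/-! ### The uniform and finitary conditions -/

/-- If Eve cannot win the bounded conditions outside of `X`, then against every strategy of Eve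
Adam can, from outside of `X`, produce infinitely many delays of the prescribed lengths. -/
theorem exists_consistent_delays {F X : Set V} {f : ℕ → ℕ} (hf : ∀ i, 1 ≤ f i)
    (hX : ∀ i, A.winE (BndBuchi (F ∪ X) (f i)) ⊆ X) (σ : A.EveStrategy) {v : V} (hv : v ∉ X) :
    ∃ π, A.Consistent σ v π ∧ ∀ i, ∃ k ≥ i, ∀ j ≤ f i, π (k + j) ∉ F := by
  have hstep : ∀ (i : ℕ) (p : {p : (ℕ → V) × ℕ // A.Consistent σ v p.1 ∧ p.1 p.2 ∉ X}),
      ∃ q : {p : (ℕ → V) × ℕ // A.Consistent σ v p.1 ∧ p.1 p.2 ∉ X},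
        (∀ k ≤ p.1.2, q.1.1 k = p.1.1 k) ∧ ∃ k ≥ p.1.2, q.1.2 = k + f i ∧
          ∀ j ≤ f i, q.1.1 (k + j) ∉ F := by
    rintro i ⟨⟨π, n⟩, hπ, hn⟩
    have h : ¬ _ := fun h => hn (hX i (A.mem_winE_iff.2 h))
    push Not at h
    obtain ⟨ρ, hρ, hρ'⟩ := h (σ.residual ((List.range n).map π))
    rw [mem_bndBuchi_iff] at hρ'
    push Not at hρ'
    obtain ⟨k, hk⟩ := hρ'
    obtain ⟨π', h1, h2, h3⟩ := hπ.splice hρ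
    -- The new mark is the last position of the window, which avoids `X` as well as `F`.
    refine ⟨⟨(π', n + k + f i), h1, ?_⟩, h2, n + k, Nat.le_add_right n k, rfl, fun j hj => ?_⟩
    · simp only [Nat.add_assoc, h3]
      exact fun h => hk (f i) le_rfl (Or.inr h)
    · simp only [Nat.add_assoc, h3]
      exact fun h => hk j hj (Or.inl h)
  choose next hagree hdelay using hstep
  obtain ⟨π₀, hπ₀⟩ := A.exists_consistent σ v
  let p : ℕ → {p : (ℕ → V) × ℕ // A.Consistent σ v p.1 ∧ p.1 p.2 ∉ X} := fun i =>
    Nat.rec ⟨(π₀, 0), hπ₀, fun h => hv (hπ₀.1 ▸ h)⟩ next i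
  have hp : ∀ i, p (i + 1) = next i (p i) := fun _ => rfl
  -- `1 ≤ f i` matters here: an empty advance could leave the marks stuck, with no limit play.
  have hlt : StrictMono fun i => (p i).1.2 := strictMono_nat_of_lt_succ fun i => by
    obtain ⟨k, hk, he, -⟩ := hdelay i (p i)
    rw [hp, he]
    have := hf i
    omega
  have hle : ∀ i, i ≤ (p i).1.2 := fun i => hlt.le_apply
  have hstable : ∀ i d, ∀ k ≤ (p i).1.2, (p (i + d)).1.1 k = (p i).1.1 k := by
    intro i d k hk
    induction d with
    | zero => rfl
    | succ d ih =>
      rw [← ih, ← Nat.add_assoc, hp]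
      exact hagree _ _ k (hk.trans (hlt.monotone (Nat.le_add_right i d)))
  have hlim : ∀ i, ∀ k ≤ (p i).1.2, (p k).1.1 k = (p i).1.1 k := by
    intro i k hk
    rw [← hstable i k k hk, Nat.add_comm i k, hstable k i k (hle k)]
  -- The diagonal play: each stage freezes the play up to its mark, and the `k`-th mark is at least
  -- `k`.
  refine ⟨fun k => (p k).1.1 k, ⟨(p 0).2.1.1, fun n => ?_⟩, fun i => ?_⟩
  · have hw : ∀ k ≤ n + 1, (p k).1.1 k = (p (n + 1)).1.1 k := fun k hk =>
      hlim (n + 1) k (hk.trans (hle (n + 1)))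
    have hw' : (List.range n).map (fun k => (p k).1.1 k) =
        (List.range n).map (p (n + 1)).1.1 :=
      List.map_congr_left fun k hk => hw k (by have := List.mem_range.1 hk; omega)
    simp only [hw', hw n n.le_succ]
    exact (p (n + 1)).2.1.2 n
  · obtain ⟨k, hk, he, h⟩ := hdelay i (p i)
    refine ⟨k, (hle i).trans hk, fun j hj => ?_⟩
    have : k + j ≤ (p (i + 1)).1.2 := by rw [hp, he]; omega
    simp only [hlim (i + 1) (k + j) this]
    exact h j hj

theorem winE_uniformBuchi (F : Set V) {N : ℕ} (hN : 1 ≤ N) :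
    A.winE (UniformBuchi F N) = (A.uniformOp N F).lfp := by
  apply Set.Subset.antisymm
  · intro v hv
    by_contra hX
    obtain ⟨σ, hσ⟩ := A.mem_winE_iff.1 hv
    obtain ⟨π, hπ, hd⟩ := exists_consistent_delays (F := F) (f := fun _ => N) (fun _ => hN)
      (fun _ => (winE_bndBuchi _ N).trans_le (A.uniformOp N F).map_lfp.le) σ hX
    obtain ⟨m, hm⟩ := mem_uniformBuchi_iff.1 (hσ π hπ)
    obtain ⟨k, hk, hk'⟩ := hd m
    obtain ⟨j, hj, hF⟩ := hm k hk
    exact hk' j hj hF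
  · refine OrderHom.lfp_le _ ?_
    refine (winE_bndBuchi _ N).symm.trans_le fun v hv =>
      mem_winE_of_switch uniformBuchi_of_suffix (A.winE_mono (fun π hπ => ?_) hv)
    refine or_iff_not_imp_left.2 fun hW => bndBuchi_subset_uniformBuchi F N ?_
    refine mem_bndBuchi_iff.2 fun k => ?_
    obtain ⟨j, hj, hF⟩ := mem_bndBuchi_iff.1 hπ k
    exact ⟨j, hj, hF.resolve_right fun h => hW ⟨_, h⟩⟩

theorem lfp_finitaryInnerOp (F X : Set V) {N : ℕ} (hN : 1 ≤ N) :
    (A.finitaryInnerOp N F X).lfp = A.winE (UniformBuchi (F ∪ X) N) := by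
  rw [winE_uniformBuchi _ hN]
  congr 1
  ext1
  funext Y
  change (A.attrPre N (F ∪ Y ∪ X)).gfp = (A.attrPre N (F ∪ X ∪ Y)).gfp
  rw [Set.union_right_comm]

theorem lfp_finitaryInnerOp_le_succ (F X : Set V) (N : ℕ) :
    (A.finitaryInnerOp N F X).lfp ≤ (A.finitaryInnerOp (N + 1) F X).lfp :=
  OrderHom.lfp.monotone fun _ => OrderHom.gfp.monotone fun _ => attr_le_attr _ N.le_succ

theorem winE_finBuchi (F : Set V) : A.winE (FinBuchi F) = (A.finitaryOp F).lfp := by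
  apply Set.Subset.antisymm
  · intro v hv
    by_contra hX
    obtain ⟨σ, hσ⟩ := A.mem_winE_iff.1 hv
    have hsub : ∀ i, A.winE (BndBuchi (F ∪ (A.finitaryOp F).lfp) (i + 1)) ⊆
        (A.finitaryOp F).lfp := fun i => by
      refine (A.winE_mono (bndBuchi_subset_uniformBuchi _ _)).trans ?_
      rw [← lfp_finitaryInnerOp F _ (Nat.le_add_left 1 i)]
      refine (Set.subset_iUnion (fun N => (A.finitaryInnerOp N F (A.finitaryOp F).lfp).lfp)
        (i + 1)).trans (A.finitaryOp F).map_lfp.le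
    obtain ⟨π, hπ, hd⟩ := exists_consistent_delays (f := fun i => i + 1)
      (fun i => Nat.le_add_left 1 i) hsub σ hX
    obtain ⟨N, hN⟩ := mem_finBuchi_iff.1 (hσ π hπ)
    obtain ⟨m, hm⟩ := mem_uniformBuchi_iff.1 hN
    -- One index puts the window past `m` and makes it longer than `N`.
    obtain ⟨k, hk, hk'⟩ := hd (max m N)
    obtain ⟨j, hj, hF⟩ := hm k ((le_max_left m N).trans hk)
    exact hk' j (hj.trans ((le_max_right m N).trans (Nat.le_succ _))) hF
  · refine OrderHom.lfp_le _ (Set.iUnion_subset fun N => ?_)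
    -- Passing to `N + 1` absorbs `N = 0`, which the uniform characterization excludes.
    refine (lfp_finitaryInnerOp_le_succ F _ N).trans ?_
    rw [lfp_finitaryInnerOp F _ (Nat.le_add_left 1 N)]
    refine fun v hv => mem_winE_of_switch (fun π n h => ?_) (A.winE_mono (fun π hπ => ?_) hv)
    · obtain ⟨M, hM⟩ := mem_finBuchi_iff.1 h
      exact mem_finBuchi_iff.2 ⟨M, uniformBuchi_of_suffix π n hM⟩
    · refine or_iff_not_imp_left.2 fun hW => mem_finBuchi_iff.2 ⟨N + 1, ?_⟩
      obtain ⟨m, hm⟩ := mem_uniformBuchi_iff.1 hπ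
      refine mem_uniformBuchi_iff.2 ⟨m, fun k hk => ?_⟩
      obtain ⟨j, hj, hF⟩ := hm k hk
      exact ⟨j, hj, hF.resolve_right fun h => hW ⟨_, h⟩⟩

end Arena

theorem mainTheorem5 {V : Type*} [Countable V] (A : Arena V) (F : Set V) :
    (∀ N : ℕ, A.winE (BndBuchi F N) = (A.attrPre N F).gfp) ∧
    (∀ N : ℕ, 1 ≤ N → A.winE (UniformBuchi F N) = (A.uniformOp N F).lfp) ∧
    A.winE (FinBuchi F) = (A.finitaryOp F).lfp :=
  ⟨Arena.winE_bndBuchi F, fun _ hN => Arena.winE_uniformBuchi F hN, Arena.winE_finBuchi F⟩
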